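/- Let $n \ge 0$ and let $f\colon \{0,1\}^n \to \{0,1\}$ be a Boolean function. Let $d(f)$ be the degree of the unique multilinear real polynomial in $n$ variables that agrees with $f$ on $\{0,1\}^n$. For $x \in \{0,1\}^n$ and $R \subseteq \{1,\dots,n\}$ let $x^{(R)}$ be $x$ with the bits in positions $i \in R$ flipped; let $bs(f,x)$ be the largest $t$ for which there are pairwise disjoint sets $R_1,\dots,R_t \subseteq \{1,\dots,n\}$ with $f(x) \ne f(x^{(R_i)})$ for all $i$, and let the block sensitivity be $bs(f) = \max_{x} bs(f,x)$. **Theorem.** For every Boolean function $f\colon \{0,1\}^n \to \{0,1\}$ with $bs(f) \neq 1$, $$ d(f)^2 \;\ge\; \sqrt{6/5}\; bs(f), \qquad\text{where } 1.09 < \sqrt{6/5} < 1.1 . $$ -/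

import Mathlib

namespace BoolFun

/-- A Boolean function `{0,1}^n → {0,1}`; `true` plays the role of 1 and `false` of 0. -/
abbrev BooleanFunction (n : ℕ) : Type := (Fin n → Bool) → Bool

/-- A bit, as a real number. -/
def bit (b : Bool) : ℝ := if b then 1 else 0

/-- The multilinear real polynomial `p` represents the Boolean function `f`: every variable has
degree at most one in `p`, and `p` agrees with `f` on `{0,1}^n`. -/
def Represents {n : ℕ} (p : MvPolynomial (Fin n) ℝ) (f : BooleanFunction n) : Prop :=
  (∀ i, p.degreeOf i ≤ 1) ∧
    ∀ x : Fin n → Bool, MvPolynomial.eval (fun i => bit (x i)) p = bit (f x)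

/-- The polynomial that represents `f`,
`∑ₐ f(a) ∏ᵢ (Xᵢ if aᵢ = 1, and 1 - Xᵢ if aᵢ = 0)`. -/
noncomputable def poly {n : ℕ} (f : BooleanFunction n) : MvPolynomial (Fin n) ℝ :=
  ∑ a : Fin n → Bool, MvPolynomial.C (bit (f a)) *
    ∏ i, (if a i then MvPolynomial.X i else 1 - MvPolynomial.X i)

theorem poly_represents {n : ℕ} (f : BooleanFunction n) : Represents (poly f) f := by
  constructor
  · intro i
    unfold poly
    refine (MvPolynomial.degreeOf_sum_le i _ _).trans (Finset.sup_le fun a _ => ?_)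
    refine (MvPolynomial.degreeOf_C_mul_le _ i _).trans
      ((MvPolynomial.degreeOf_prod_le i _ _).trans ?_)
    calc ∑ j, MvPolynomial.degreeOf i
            (if a j then (MvPolynomial.X j : MvPolynomial (Fin n) ℝ) else 1 - MvPolynomial.X j)
        ≤ ∑ j, (if i = j then 1 else 0) := by
          refine Finset.sum_le_sum fun j _ => ?_
          have hX : MvPolynomial.degreeOf i (MvPolynomial.X j : MvPolynomial (Fin n) ℝ)
              = if i = j then 1 else 0 := by
            rw [MvPolynomial.degreeOf_X]
          have h1 : MvPolynomial.degreeOf i (1 : MvPolynomial (Fin n) ℝ) = 0 :=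
            MvPolynomial.degreeOf_one i
          by_cases ha : a j = true
          · rw [if_pos ha, hX]
          · rw [if_neg ha]
            refine (MvPolynomial.degreeOf_sub_le i _ _).trans ?_
            rw [hX, h1]
            simp
      _ = 1 := by simp
  · intro x
    unfold poly
    rw [map_sum, Finset.sum_eq_single x]
    · rw [map_mul, MvPolynomial.eval_C, map_prod, Finset.prod_eq_one, mul_one]
      intro i _
      cases h : x i <;> simp [h, bit]
    · intro a _ hne
      obtain ⟨i, hi⟩ := Function.ne_iff.mp hne
      rw [map_mul, map_prod, Finset.prod_eq_zero (Finset.mem_univ i), mul_zero]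
      cases h : a i <;> cases h' : x i <;> simp_all [bit]
    · simp

/-- The representing polynomial is unique. -/
theorem Represents.eq_poly {n : ℕ} {f : BooleanFunction n} {p : MvPolynomial (Fin n) ℝ}
    (hp : Represents p f) : p = poly f := by
  rw [← sub_eq_zero]
  refine MvPolynomial.eq_zero_of_eval_zero_at_prod_finset _ (fun _ => ({0, 1} : Finset ℝ)) ?_ ?_
  · intro i
    have h := MvPolynomial.degreeOf_sub_le i p (poly f)
    have h1 := hp.1 i
    have h2 := (poly_represents f).1 i
    have hc : ({0, 1} : Finset ℝ).card = 2 := Finset.card_pair zero_ne_one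
    rw [hc]
    have := max_le h1 h2
    omega
  · intro y hy
    have hx : y = fun i => bit (decide (y i = 1)) := by
      funext i
      have := hy i
      simp only [Finset.mem_insert, Finset.mem_singleton] at this
      rcases this with h | h <;> simp [bit, h]
    rw [hx, map_sub, hp.2 (fun i => decide (y i = 1)),
      (poly_represents f).2 (fun i => decide (y i = 1)), sub_self]

/-- `d(f)`, the degree of the polynomial that represents `f`. -/
noncomputable def degree {n : ℕ} (f : BooleanFunction n) : ℕ := (poly f).totalDegree

/-- `x^{(R)}`: the input `x` with the bits in the block `R` flipped. -/
def flip {n : ℕ} (x : Fin n → Bool) (R : Finset (Fin n)) : Fin n → Bool :=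
  fun i => if i ∈ R then !(x i) else x i

/-- The local block sensitivity `bs(f, x)`: the largest number of pairwise disjoint blocks `R`
with `f(x) ≠ f(x^{(R)})` (such blocks are non-empty, so a disjoint family of them is a set). -/
def localBlockSensitivity {n : ℕ} (f : BooleanFunction n) (x : Fin n → Bool) : ℕ :=
  ((Finset.univ : Finset (Finset (Finset (Fin n)))).filter fun B =>
    (∀ R ∈ B, ∀ S ∈ B, R ≠ S → Disjoint R S) ∧ ∀ R ∈ B, f x ≠ f (flip x R)).sup Finset.card

/-- The block sensitivity `bs(f)`, the maximum of `bs(f, x)` over all inputs `x`. -/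
def blockSensitivity {n : ℕ} (f : BooleanFunction n) : ℕ :=
  (Finset.univ : Finset (Fin n → Bool)).sup (localBlockSensitivity f)

end BoolFun

namespace BoolFun

open Polynomial Polynomial.Chebyshev

theorem prod_sub_second_difference_nonneg (s : Finset ℕ) (a : ℕ → ℝ) {y h : ℝ} (hh : 0 ≤ h)
    (ha : ∀ i ∈ s, a i ≤ y - h) :
    0 ≤ ∏ i ∈ s, (y - h - a i) ∧ ∏ i ∈ s, (y - h - a i) ≤ ∏ i ∈ s, (y - a i) ∧
      ∏ i ∈ s, (y - a i) ≤ ∏ i ∈ s, (y + h - a i) ∧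
      2 * ∏ i ∈ s, (y - a i) ≤ ∏ i ∈ s, (y + h - a i) + ∏ i ∈ s, (y - h - a i) := by
  induction s using Finset.induction_on with
  | empty => norm_num
  | insert j s hj ih =>
    obtain ⟨h0, h1, h2, h3⟩ := ih fun i hi => ha i (Finset.mem_insert_of_mem hi)
    have hb := ha j (Finset.mem_insert_self _ _)
    simp only [Finset.prod_insert hj]
    generalize ∏ i ∈ s, (y - h - a i) = u at *
    generalize ∏ i ∈ s, (y - a i) = v at *
    generalize ∏ i ∈ s, (y + h - a i) = w at *
    obtain ⟨b, hb', hb0⟩ : ∃ b, y - a j = b + h ∧ 0 ≤ b := ⟨y - a j - h, by ring, by linarith⟩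
    have e1 : y - h - a j = b := by linarith
    have e2 : y + h - a j = b + 2 * h := by linarith
    rw [e1, e2, hb']
    refine ⟨by positivity, ?_, ?_, ?_⟩
    · nlinarith [mul_nonneg hb0 (sub_nonneg.2 h1), mul_nonneg hh (h0.trans h1)]
    · nlinarith [mul_nonneg hb0 (sub_nonneg.2 h2), mul_nonneg hh (sub_nonneg.2 h2),
        mul_nonneg hh ((h0.trans h1).trans h2)]
    · nlinarith [mul_nonneg hb0 (sub_nonneg.2 h3), mul_nonneg hh (sub_nonneg.2 h2)]

theorem prod_sub_node_second_difference_nonneg {n i : ℕ} {h : ℝ} (hh : 0 ≤ h)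
    (hn : node n 1 ≤ 1 - 2 * h) :
    0 ≤ ∏ j ∈ (Finset.range (n + 1)).erase i, (1 - node n j)
      - 2 * ∏ j ∈ (Finset.range (n + 1)).erase i, (1 - h - node n j)
      + ∏ j ∈ (Finset.range (n + 1)).erase i, (1 - 2 * h - node n j) := by
  have hle : ∀ j ∈ Finset.range (n + 1), j ≠ 0 → node n j ≤ 1 - h - h := by
    intro j hj hj0
    have hj' : j ≤ n := Finset.mem_range_succ_iff.1 hj
    rcases (Nat.one_le_iff_ne_zero.2 hj0).eq_or_lt with rfl | h1
    · linarith
    · linarith [node_lt hj' h1]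
  by_cases hi : i = 0
  · subst hi
    obtain ⟨-, -, -, h3⟩ := prod_sub_second_difference_nonneg ((Finset.range (n + 1)).erase 0)
      (node n) (y := 1 - h) hh fun j hj => hle j (Finset.mem_of_mem_erase hj)
        (Finset.ne_of_mem_erase hj)
    rw [show (1 : ℝ) - h + h = 1 by ring, show (1 : ℝ) - h - h = 1 - 2 * h by ring] at h3
    linarith
  · have h0 : 0 ∈ (Finset.range (n + 1)).erase i := by simp [Ne.symm hi]
    obtain ⟨-, h1, -, -⟩ := prod_sub_second_difference_nonneg
      (((Finset.range (n + 1)).erase i).erase 0) (node n) (y := 1 - h) hh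
        fun j hj => hle j (Finset.mem_of_mem_erase (Finset.mem_of_mem_erase hj))
          (Finset.ne_of_mem_erase hj)
    rw [← Finset.mul_prod_erase _ _ h0, ← Finset.mul_prod_erase _ _ h0,
      ← Finset.mul_prod_erase _ _ h0, node_eq_one]
    rw [show (1 : ℝ) - h - h = 1 - 2 * h by ring] at h1
    nlinarith [mul_le_mul_of_nonneg_left h1 hh]

theorem second_difference_eq_sumNodes {n : ℕ} {P : ℝ[X]} (hP : P.degree ≤ n) (h : ℝ) :
    P.eval 1 - 2 * P.eval (1 - h) + P.eval (1 - 2 * h) =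
      sumNodes n (fun i => (∏ j ∈ (Finset.range (n + 1)).erase i, (node n i - node n j))⁻¹ *
        (∏ j ∈ (Finset.range (n + 1)).erase i, (1 - node n j)
          - 2 * ∏ j ∈ (Finset.range (n + 1)).erase i, (1 - h - node n j)
          + ∏ j ∈ (Finset.range (n + 1)).erase i, (1 - 2 * h - node n j))) P := by
  have hd : P.degree < (Finset.range (n + 1)).card := by
    rw [Finset.card_range]
    exact hP.trans_lt (by exact_mod_cast n.lt_succ_self)
  have key : ∀ x, P.eval x = ∑ i ∈ Finset.range (n + 1),
      (P.eval (node n i) / ∏ j ∈ (Finset.range (n + 1)).erase i, (node n i - node n j)) *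
        ∏ j ∈ (Finset.range (n + 1)).erase i, (x - node n j) := by
    intro x
    conv_lhs => rw [Lagrange.eq_interpolate (strictAntiOn_node n).injOn hd]
    rw [Lagrange.interpolate_eq_sum]
    simp [eval_finsetSum, eval_prod]
  rw [key 1, key (1 - h), key (1 - 2 * h), sumNodes, ← Nat.range_succ_eq_Iic, Finset.mul_sum,
    ← Finset.sum_sub_distrib, ← Finset.sum_add_distrib]
  refine Finset.sum_congr rfl fun i _ => ?_
  ring

theorem second_difference_le_of_forall_abs_le_one {n : ℕ} {P : ℝ[X]} (hP : P.degree ≤ n)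
    (hPb : ∀ x ∈ Set.Icc (-1) 1, |P.eval x| ≤ 1) {h : ℝ} (hh : 0 ≤ h)
    (hn : node n 1 ≤ 1 - 2 * h) :
    P.eval 1 - 2 * P.eval (1 - h) + P.eval (1 - 2 * h) ≤
      (T ℝ n).eval 1 - 2 * (T ℝ n).eval (1 - h) + (T ℝ n).eval (1 - 2 * h) := by
  rw [second_difference_eq_sumNodes hP, second_difference_eq_sumNodes (degree_T ℝ n).le]
  refine sumNodes_le_sumNodes_T (fun i hi => ?_) hPb
  rw [← mul_assoc]
  refine mul_nonneg ?_ (prod_sub_node_second_difference_nonneg hh hn)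
  have := inv_pos_of_pos <| zero_lt_prod_node_sub_node hi
  rw [mul_inv, ← inv_pow, inv_neg_one] at this
  exact this.le

open Real in
theorem sin_sqrt_two_mul_le {x : ℝ} (hx : 0 ≤ x) (hx' : √2 * x ≤ π) :
    sin (√2 * x) ≤ √2 * sin x := by
  have h2 : 0 < √2 := by positivity
  have h21 : 1 ≤ √2 := Real.one_le_sqrt.2 one_le_two
  have hi : (√2)⁻¹ ≤ 1 := inv_le_one_of_one_le₀ h21
  have := strictConcaveOn_sin_Icc.concaveOn.2 (⟨by positivity, hx'⟩ : √2 * x ∈ Set.Icc 0 π)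
    (⟨le_rfl, pi_pos.le⟩ : (0 : ℝ) ∈ Set.Icc 0 π) (inv_nonneg.2 h2.le)
    (sub_nonneg.2 hi) (add_sub_cancel _ _)
  simp only [smul_eq_mul, sin_zero, mul_zero, add_zero] at this
  rw [inv_mul_cancel_left₀ h2.ne'] at this
  rw [inv_mul_le_iff₀ h2] at this
  exact this

open Real in
theorem one_sub_two_cos_add_cos_le {a : ℝ} (ha : 0 ≤ a) (ha' : √2 * a ≤ π) :
    1 - 2 * cos a + cos (√2 * a) ≤ 5 / 4 := by
  have h2 : 0 < √2 := by positivity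
  have hsq : √2 * √2 = 2 := Real.mul_self_sqrt (by norm_num)
  have mono : MonotoneOn (fun a => 1 - 2 * cos a + cos (√2 * a)) (Set.Icc 0 (π / √2)) := by
    refine monotoneOn_of_deriv_nonneg (convex_Icc _ _) (by fun_prop) (by fun_prop) fun x hx => ?_
    rw [interior_Icc] at hx
    have hd : HasDerivAt (fun a => 1 - 2 * cos a + cos (√2 * a))
        (0 - 2 * (-sin x) + (-sin (√2 * x) * (√2 * 1))) x :=
      ((hasDerivAt_const x (1 : ℝ)).sub ((hasDerivAt_cos x).const_mul 2)).add
        (((hasDerivAt_id x).const_mul √2).cos)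
    rw [hd.deriv]
    have := sin_sqrt_two_mul_le hx.1.le ((lt_div_iff₀' h2).1 hx.2).le
    have h3 := mul_le_mul_of_nonneg_left this h2.le
    rw [← mul_assoc, hsq] at h3
    linarith
  have hle : a ≤ π / √2 := (le_div_iff₀' h2).2 ha'
  have h0 : 0 ≤ π / √2 := by positivity
  refine (mono ⟨ha, hle⟩ ⟨h0, le_rfl⟩ hle).trans ?_
  simp only
  rw [mul_div_cancel₀ _ h2.ne', cos_pi]
  have e : π / √2 = π - 2 * ((π - π / √2) / 2) := by ring
  have hdiv : π / √2 = π * √2 / 2 := by field_simp; linarith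
  set t := (π - π / √2) / 2 with ht
  have hs1 : √2 < 1.415 := by
    rw [Real.sqrt_lt' (by norm_num)]; norm_num
  have hs2 : 1.41 < √2 := by
    rw [Real.lt_sqrt (by norm_num)]; norm_num
  have ht1 : 0.455 ≤ t := by
    rw [ht, hdiv]; nlinarith [pi_gt_d2]
  have hsin : 0.434 ≤ sin t := by
    have h1 : sin 0.455 ≤ sin t :=
      sin_le_sin_of_le_of_le_pi_div_two (by linarith [pi_pos])
        (by rw [ht]; linarith) ht1
    have h3 := sin_gt_sub_cube (x := 0.455) (by norm_num)
    norm_num at h3 h1 ⊢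
    linarith
  rw [e, cos_pi_sub, cos_two_mul, cos_sq']
  nlinarith

open Real in
theorem second_difference_T_le {n : ℕ} (hn1 : 1 ≤ n) {h : ℝ} (hh : 0 ≤ h)
    (hn : node n 1 ≤ 1 - 2 * h) :
    (T ℝ n).eval 1 - 2 * (T ℝ n).eval (1 - h) + (T ℝ n).eval (1 - 2 * h) ≤ 5 / 4 := by
  have h2 : 0 < √2 := by positivity
  have h1 : -1 ≤ 1 - 2 * h := (neg_one_le_cos _).trans hn
  have hn0 : (0 : ℝ) < n := by exact_mod_cast hn1
  set α := arccos (1 - h) with hα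
  set β := arccos (1 - 2 * h) with hβ
  have cα : cos α = 1 - h := cos_arccos (by linarith) (by linarith)
  have cβ : cos β = 1 - 2 * h := cos_arccos h1 (by linarith)
  have hβn : β ≤ π / n := by
    have : arccos (cos (π / n)) = π / n := arccos_cos (by positivity)
      (div_le_self pi_pos.le (by exact_mod_cast hn1))
    rw [← this]
    apply arccos_le_arccos
    simpa [node] using hn
  have hα0 : 0 ≤ α := arccos_nonneg _
  have hαh : α ≤ π / 2 := by
    rw [hα, arccos_le_pi_div_two]; linarith
  have hs2 : √2 < 1.5 := by
    rw [Real.sqrt_lt' (by norm_num)]; norm_num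
  have hαπ : √2 * α ≤ π := by nlinarith [pi_pos]
  have hαβ : √2 * α ≤ β := by
    rw [← arccos_cos (x := √2 * α) (by positivity) hαπ, hβ]
    apply arccos_le_arccos
    have e1 : cos (√2 * α) = 1 - 2 * sin (√2 * (α / 2)) ^ 2 := by
      rw [show √2 * α = 2 * (√2 * (α / 2)) by ring, cos_two_mul, cos_sq']; ring
    have e2 : 1 - h = 1 - 2 * sin (α / 2) ^ 2 := by
      rw [← cα, show α = 2 * (α / 2) by ring, cos_two_mul, cos_sq']; ring_nf
    have hs := sin_sqrt_two_mul_le (x := α / 2) (by positivity) (by linarith)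
    have hs0 : 0 ≤ sin (√2 * (α / 2)) :=
      sin_nonneg_of_nonneg_of_le_pi (by positivity) (by linarith)
    have hsq : √2 ^ 2 = 2 := Real.sq_sqrt (by norm_num)
    have := pow_le_pow_left₀ hs0 hs 2
    rw [mul_pow, hsq] at this
    rw [e1]; linarith
  have hnβ : n * β ≤ π := (le_div_iff₀' hn0).1 hβn
  have hna : √2 * (n * α) ≤ n * β := by nlinarith
  have key := one_sub_two_cos_add_cos_le (a := n * α) (by positivity) (hna.trans hnβ)
  have hcos : cos (n * β) ≤ cos (√2 * (n * α)) :=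
    cos_le_cos_of_nonneg_of_le_pi (by positivity) hnβ hna
  rw [← cα, ← cβ]
  simp only [T_eval_one, T_real_cos, Int.cast_natCast]
  linarith

theorem abs_eval_one_iterate_derivative_le {n : ℕ} {P : ℝ[X]} (hP : P.degree ≤ n)
    (hPb : ∀ x ∈ Set.Icc (-1) 1, |P.eval x| ≤ 1) (k : ℕ) :
    |(derivative^[k] P).eval 1| ≤ (derivative^[k] (T ℝ n)).eval 1 := by
  rw [abs_le']
  refine ⟨eval_iterate_derivative_le_of_forall_abs_le_one le_rfl hP hPb, ?_⟩
  have := eval_iterate_derivative_le_of_forall_abs_le_one (P := -P) (k := k) (le_refl (1 : ℝ))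
    (by rwa [degree_neg]) (by simpa using hPb)
  simpa [iterate_derivative_neg] using this

theorem abs_eval_one_derivative_le {n : ℕ} {P : ℝ[X]} (hP : P.degree ≤ n)
    (hPb : ∀ x ∈ Set.Icc (-1) 1, |P.eval x| ≤ 1) :
    |(derivative P).eval 1| ≤ (n : ℝ) ^ 2 := by
  have := abs_eval_one_iterate_derivative_le hP hPb 1
  rwa [Function.iterate_one, derivative_T_eval_one, Int.cast_natCast] at this

theorem abs_eval_one_second_derivative_le {n : ℕ} {P : ℝ[X]} (hP : P.degree ≤ n)
    (hPb : ∀ x ∈ Set.Icc (-1) 1, |P.eval x| ≤ 1) :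
    |(derivative (derivative P)).eval 1| ≤ (n : ℝ) ^ 2 * ((n : ℝ) ^ 2 - 1) / 3 := by
  have := abs_eval_one_iterate_derivative_le hP hPb 2
  rw [iterate_derivative_T_eval_one_eq_div] at this
  refine this.trans_eq ?_
  norm_num [Finset.prod_range_succ]

theorem degree_comp_C_mul_X_add_C_le {n : ℕ} {P : ℝ[X]} (hP : P.degree ≤ n) (a b : ℝ) :
    (P.comp (C a * X + C b)).degree ≤ n := by
  rw [← natDegree_le_iff_degree_le] at hP ⊢
  refine natDegree_comp_le.trans ?_
  calc P.natDegree * (C a * X + C b).natDegree ≤ n * 1 :=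
        Nat.mul_le_mul hP natDegree_linear_le
    _ = n := mul_one n

theorem eval_derivative_comp_C_mul_X_add_C (P : ℝ[X]) (a b x : ℝ) :
    (derivative (P.comp (C a * X + C b))).eval x = a * (derivative P).eval (a * x + b) := by
  simp [derivative_comp]

theorem eval_second_derivative_comp_C_mul_X_add_C (P : ℝ[X]) (a b x : ℝ) :
    (derivative (derivative (P.comp (C a * X + C b)))).eval x =
      a ^ 2 * (derivative (derivative P)).eval (a * x + b) := by
  simp [derivative_comp]
  ring

theorem abs_second_derivative_le_of_nonneg {n : ℕ} {P : ℝ[X]} (hP : P.degree ≤ n)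
    (hPb : ∀ x ∈ Set.Icc (-1) 1, |P.eval x| ≤ 1) {x : ℝ} (hx : 0 ≤ x) (hx1 : x ≤ 1) :
    ((1 + x) / 2) ^ 2 * |(derivative (derivative P)).eval x| ≤
      (n : ℝ) ^ 2 * ((n : ℝ) ^ 2 - 1) / 3 := by
  have := abs_eval_one_second_derivative_le
    (degree_comp_C_mul_X_add_C_le hP ((1 + x) / 2) ((x - 1) / 2)) (by
      intro y hy
      simp only [eval_comp, eval_add, eval_mul, eval_C, eval_X]
      apply hPb
      constructor <;> nlinarith [hy.1, hy.2])
  rw [eval_second_derivative_comp_C_mul_X_add_C, abs_mul, abs_of_nonneg (by positivity)] at this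
  rwa [show (1 + x) / 2 * 1 + (x - 1) / 2 = x by ring] at this

theorem abs_second_derivative_le_of_endpoint {n : ℕ} {P : ℝ[X]} (hP : P.degree ≤ n)
    (hPb : ∀ x ∈ Set.Icc (-1) 1, |P.eval x| ≤ 1) {x : ℝ} (hx1 : |x| ≤ 1) :
    ((1 + |x|) / 2) ^ 2 * |(derivative (derivative P)).eval x| ≤
      (n : ℝ) ^ 2 * ((n : ℝ) ^ 2 - 1) / 3 := by
  rcases le_total 0 x with hx | hx
  · rw [abs_of_nonneg hx] at hx1 ⊢
    exact abs_second_derivative_le_of_nonneg hP hPb hx hx1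
  · rw [abs_of_nonpos hx] at hx1 ⊢
    have := abs_second_derivative_le_of_nonneg
      (degree_comp_C_mul_X_add_C_le hP (-1) 0) (by
        intro y hy
        simp only [eval_comp, eval_add, eval_mul, eval_C, eval_X]
        apply hPb
        constructor <;> linarith [hy.1, hy.2]) (neg_nonneg.2 hx) hx1
    rw [eval_second_derivative_comp_C_mul_X_add_C] at this
    simpa using this

/-- `Q(y²)` is the even part of `P(y)` for `Q = contract 2 P`. -/
theorem eval_contract_two (P : ℝ[X]) (y : ℝ) :
    2 * (contract 2 P).eval (y ^ 2) = P.eval y + P.eval (-y) := by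
  induction P using Polynomial.induction_on' with
  | add p q hp hq =>
    rw [contract_add two_ne_zero, eval_add, eval_add, eval_add, mul_add, hp, hq]; ring
  | monomial k a =>
    rcases Nat.even_or_odd' k with ⟨j, rfl | rfl⟩
    · have : contract 2 (monomial (2 * j) a) = monomial j a := by
        ext i
        rw [coeff_contract two_ne_zero, coeff_monomial, coeff_monomial]
        congr 1
        simp only [eq_iff_iff]; omega
      rw [this]
      simp only [eval_monomial]
      rw [← pow_mul, Even.neg_pow (even_two_mul j)]; ring
    · have : contract 2 (monomial (2 * j + 1) a) = 0 := by
        ext i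
        rw [coeff_contract two_ne_zero, coeff_monomial, if_neg (by omega), coeff_zero]
      rw [this]
      simp only [eval_monomial, eval_zero]
      rw [Odd.neg_pow (odd_two_mul_add_one j)]; ring

theorem natDegree_contract_two_le (P : ℝ[X]) : (contract 2 P).natDegree ≤ P.natDegree / 2 := by
  rw [natDegree_le_iff_coeff_eq_zero]
  intro k hk
  rw [coeff_contract two_ne_zero]
  exact coeff_eq_zero_of_natDegree_lt (by omega)

theorem abs_second_derivative_le_of_interior {n : ℕ} {P : ℝ[X]} (hP : P.degree ≤ n)
    (hPb : ∀ x ∈ Set.Icc (-1) 1, |P.eval x| ≤ 1) {x : ℝ} (hx1 : |x| ≤ 1) :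
    (1 - |x|) ^ 2 * |(derivative (derivative P)).eval x| ≤ (n : ℝ) ^ 2 := by
  set r := 1 - |x| with hr
  have hr0 : 0 ≤ r := by linarith
  set Q := contract 2 (taylor x P) with hQ
  have hQd : Q.degree ≤ (n / 2 : ℕ) := by
    rw [← natDegree_le_iff_degree_le]
    refine (natDegree_contract_two_le _).trans (Nat.div_le_div_right ?_)
    rwa [natDegree_taylor, natDegree_le_iff_degree_le]
  have hQb : ∀ z ∈ Set.Icc 0 (r ^ 2), |Q.eval z| ≤ 1 := by
    intro z hz
    have h1 : √z ≤ r := (Real.sqrt_le_left hr0).2 hz.2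
    have h0 := Real.sqrt_nonneg z
    have e := eval_contract_two (taylor x P) (√z)
    rw [Real.sq_sqrt hz.1, taylor_eval, taylor_eval] at e
    obtain ⟨ha, hb⟩ := abs_le.1 (show |x| ≤ 1 - √z by linarith)
    have b1 := abs_le.1 (hPb (√z + x) ⟨by linarith, by linarith⟩)
    have b2 := abs_le.1 (hPb (-√z + x) ⟨by linarith, by linarith⟩)
    rw [abs_le]
    constructor <;> linarith [b1.1, b1.2, b2.1, b2.2]
  have hM := abs_eval_one_derivative_le
    (degree_comp_C_mul_X_add_C_le hQd (-(r ^ 2 / 2)) (r ^ 2 / 2)) (by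
      intro y hy
      simp only [eval_comp, eval_add, eval_mul, eval_C, eval_X]
      apply hQb
      have := sq_nonneg r
      constructor <;> nlinarith [hy.1, hy.2])
  rw [eval_derivative_comp_C_mul_X_add_C, mul_one, neg_add_cancel, ← coeff_zero_eq_eval_zero,
    coeff_derivative, hQ, coeff_contract two_ne_zero, taylor_coeff, abs_mul, abs_neg,
    abs_of_nonneg (by positivity)] at hM
  have hh : (derivative (derivative P)).eval x = 2 * (hasseDeriv 2 P).eval x := by
    have := congrArg (fun f => (f P).eval x) (factorial_smul_hasseDeriv (R := ℝ) (k := 2))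
    simp at this
    rw [← this]
  have hn2 : ((n / 2 : ℕ) : ℝ) ≤ n / 2 := Nat.cast_div_le
  rw [hh, abs_mul, abs_two]
  norm_num at hM
  have hn3 : (((n / 2 : ℕ) : ℝ)) ^ 2 ≤ (n / 2) ^ 2 := by gcongr
  nlinarith

theorem abs_second_derivative_le {n : ℕ} (hn : 2 ≤ n) {P : ℝ[X]} (hP : P.degree ≤ n)
    (hPb : ∀ x ∈ Set.Icc (-1) 1, |P.eval x| ≤ 1) {x : ℝ} (hx1 : |x| ≤ 1) :
    |(derivative (derivative P)).eval x| ≤ 3 / 5 * (n : ℝ) ^ 4 := by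
  have h1 := abs_second_derivative_le_of_endpoint hP hPb hx1
  have h2 := abs_second_derivative_le_of_interior hP hPb hx1
  set D := |(derivative (derivative P)).eval x|
  have hD : 0 ≤ D := abs_nonneg _
  have hx0 := abs_nonneg x
  rcases hn.eq_or_lt with rfl | hn3
  · norm_num at h1 h2 ⊢
    rcases le_total (1 / 3) |x| with h | h
    · have : (4 / 9 : ℝ) ≤ ((1 + |x|) / 2) ^ 2 := by nlinarith
      nlinarith
    · have : (4 / 9 : ℝ) ≤ (1 - |x|) ^ 2 := by nlinarith
      nlinarith
  · have hn9 : (9 : ℝ) ≤ (n : ℝ) ^ 2 := by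
      have : (3 : ℝ) ≤ n := by exact_mod_cast hn3
      nlinarith
    rw [show (n : ℝ) ^ 4 = (n : ℝ) ^ 2 * (n : ℝ) ^ 2 by ring]
    set N := (n : ℝ) ^ 2
    rcases le_total (1 / 2) |x| with h | h
    · have : (9 / 16 : ℝ) ≤ ((1 + |x|) / 2) ^ 2 := by nlinarith
      nlinarith
    · have : (1 / 4 : ℝ) ≤ (1 - |x|) ^ 2 := by nlinarith
      nlinarith

theorem eval_le_of_second_derivative_le {p : ℝ[X]} {A a b : ℝ} (hab : a ≤ b)
    (ha : (derivative p).eval a = 0)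
    (hA : ∀ t ∈ Set.Icc a b, (derivative (derivative p)).eval t ≤ A) :
    p.eval b ≤ p.eval a + A / 2 * (b - a) ^ 2 := by
  have h1 : ∀ t ∈ Set.Icc a b, (derivative p).eval t ≤ A * (t - a) := by
    intro t ht
    have := (convex_Icc a b).image_sub_le_mul_sub_of_deriv_le
      (f := fun x => (derivative p).eval x) (by fun_prop) (by fun_prop)
      (fun x hx => by
        rw [Polynomial.deriv]; exact hA x (interior_subset hx)) a ⟨le_rfl, hab⟩ t ht ht.1
    simp only [ha] at this
    linarith
  have anti : AntitoneOn (fun t => p.eval t - A / 2 * (t - a) ^ 2) (Set.Icc a b) := by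
    refine antitoneOn_of_deriv_nonpos (convex_Icc _ _) (by fun_prop) (by fun_prop) fun t ht => ?_
    have hd : HasDerivAt (fun t => p.eval t - A / 2 * (t - a) ^ 2)
        ((derivative p).eval t - A / 2 * (2 * (t - a))) t := by
      have := (p.hasDerivAt t).fun_sub ((((hasDerivAt_id t).sub_const a).fun_pow 2).const_mul (A / 2))
      simpa using this
    rw [hd.deriv]
    linarith [h1 t (interior_subset ht)]
  have := anti ⟨le_rfl, hab⟩ ⟨hab, le_rfl⟩ hab
  simp only [sub_self] at this
  linarith

theorem eval_le_of_second_derivative_le_uIcc {p : ℝ[X]} {A a b : ℝ}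
    (ha : (derivative p).eval a = 0)
    (hA : ∀ t ∈ Set.uIcc a b, (derivative (derivative p)).eval t ≤ A) :
    p.eval b ≤ p.eval a + A / 2 * (b - a) ^ 2 := by
  rcases le_total a b with hab | hab
  · rw [Set.uIcc_of_le hab] at hA
    exact eval_le_of_second_derivative_le hab ha hA
  · rw [Set.uIcc_of_ge hab] at hA
    have := eval_le_of_second_derivative_le (p := p.comp (C (-1) * X + C 0)) (A := A)
      (neg_le_neg hab) (by rw [eval_derivative_comp_C_mul_X_add_C]; simpa using ha) (by
        intro t ht
        rw [eval_second_derivative_comp_C_mul_X_add_C]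
        have := hA (-t) ⟨by linarith [ht.2], by linarith [ht.1]⟩
        simpa using this)
    simp only [eval_comp, eval_add, eval_mul, eval_C, eval_X] at this
    norm_num at this
    linarith [this, show A / 2 * (b - a) ^ 2 = A / 2 * (-b + a) ^ 2 by ring]

theorem abs_eval_sub_le_of_abs_second_derivative_le {p : ℝ[X]} {A a b : ℝ}
    (ha : (derivative p).eval a = 0)
    (hA : ∀ t ∈ Set.uIcc a b, |(derivative (derivative p)).eval t| ≤ A) :
    |p.eval b - p.eval a| ≤ A / 2 * (b - a) ^ 2 := by
  have h1 := eval_le_of_second_derivative_le_uIcc ha fun t ht => (abs_le.1 (hA t ht)).2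
  have h2 := eval_le_of_second_derivative_le_uIcc (p := -p) (A := A) (a := a) (b := b)
    (by simpa using ha) (fun t ht => by
      have := (abs_le.1 (hA t ht)).1
      simp only [derivative_neg, eval_neg]; linarith)
  simp only [eval_neg] at h2
  rw [abs_le]
  constructor <;> linarith

/-- The supremum on `[0, m]` of a polynomial that is at most `1/2` in absolute value at the
integer points exceeds `1/2` by at most an eighth of the supremum of its second derivative. -/
theorem sup_le_of_forall_nat {g : ℝ[X]} {m : ℕ} {A B : ℝ} (hA0 : 0 ≤ A)
    (hg : ∀ k : ℕ, k ≤ m → |g.eval (k : ℝ)| ≤ 1 / 2) {ξ : ℝ} (hξ : ξ ∈ Set.Icc (0 : ℝ) m)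
    (hmax : ∀ t ∈ Set.Icc (0 : ℝ) m, |g.eval t| ≤ |g.eval ξ|) (hB : |g.eval ξ| = B)
    (hA : ∀ t ∈ Set.Icc (0 : ℝ) m, |(derivative (derivative g)).eval t| ≤ A) :
    B ≤ 1 / 2 + A / 8 := by
  subst hB
  rcases hξ.1.eq_or_lt with h0 | h0
  · have := hg 0 (Nat.zero_le _)
    rw [Nat.cast_zero] at this
    rw [← h0]; linarith
  rcases hξ.2.eq_or_lt with h1 | h1
  · have := hg m le_rfl
    rw [h1]; linarith
  have hd : (derivative g).eval ξ = 0 := by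
    have hnhds : Set.Icc (0 : ℝ) m ∈ nhds ξ := Icc_mem_nhds h0 h1
    rw [← Polynomial.deriv]
    rcases le_total 0 (g.eval ξ) with hs | hs
    · refine IsLocalMax.deriv_eq_zero ?_
      filter_upwards [hnhds] with t ht
      have := hmax t ht
      rw [abs_of_nonneg hs] at this
      exact (le_abs_self _).trans this
    · refine IsLocalMin.deriv_eq_zero ?_
      filter_upwards [hnhds] with t ht
      have := hmax t ht
      rw [abs_of_nonpos hs] at this
      linarith [neg_abs_le (g.eval t)]
  obtain ⟨k, hk, hkξ⟩ : ∃ k : ℕ, k ≤ m ∧ |(k : ℝ) - ξ| ≤ 1 / 2 := by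
    have hf := Nat.floor_le hξ.1
    have hf' := Nat.lt_floor_add_one ξ
    have hfm : ⌊ξ⌋₊ < m := (Nat.floor_lt hξ.1).2 h1
    rcases le_total (ξ - ⌊ξ⌋₊) (1 / 2) with h | h
    · exact ⟨⌊ξ⌋₊, hfm.le, by rw [abs_le]; constructor <;> linarith⟩
    · refine ⟨⌊ξ⌋₊ + 1, hfm, ?_⟩
      push_cast
      rw [abs_le]; constructor <;> linarith
  have hkm : (k : ℝ) ∈ Set.Icc (0 : ℝ) m := ⟨Nat.cast_nonneg k, by exact_mod_cast hk⟩
  have := abs_eval_sub_le_of_abs_second_derivative_le (b := (k : ℝ)) hd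
    fun t ht => hA t ((Set.ordConnected_Icc.uIcc_subset hξ hkm) ht)
  have hk2 : ((k : ℝ) - ξ) ^ 2 ≤ 1 / 4 := by
    rw [← sq_abs]
    nlinarith [abs_nonneg ((k : ℝ) - ξ)]
  have h3 := hg k hk
  have h4 := abs_sub_abs_le_abs_sub (g.eval ξ) (g.eval (k : ℝ))
  rw [abs_sub_comm] at h4
  nlinarith

theorem node_one_le {n m : ℕ} (hn : 2 ≤ n) (hm : 4 ≤ m)
    (hnm : (n : ℝ) ^ 4 < 6 / 5 * (m : ℝ) ^ 2) : node n 1 ≤ 1 - 2 * (2 / (m : ℝ)) := by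
  have hm0 : (4 : ℝ) ≤ m := by exact_mod_cast hm
  have hn0 : (2 : ℝ) ≤ n := by exact_mod_cast hn
  have e : node n 1 = 1 - 2 * Real.sin (Real.pi / (2 * n)) ^ 2 := by
    rw [node, Nat.cast_one, one_mul,
      show Real.pi / n = 2 * (Real.pi / (2 * n)) by field_simp, Real.cos_two_mul, Real.cos_sq']
    ring
  rw [e]
  rcases hn.eq_or_lt with rfl | hn3
  · have : (2 : ℝ) / m ≤ 1 / 2 := by
      rw [div_le_div_iff₀ (by linarith) (by norm_num)]; linarith
    rw [show Real.pi / (2 * (2 : ℕ)) = Real.pi / 4 by norm_num, Real.sin_pi_div_four, div_pow,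
      Real.sq_sqrt (by norm_num)]
    linarith
  · have hn3' : (3 : ℝ) ≤ n := by exact_mod_cast hn3
    have hi : 3 / (n : ℝ) ≤ 1 := (div_le_one (by linarith)).2 hn3'
    have hsin := strictConcaveOn_sin_Icc.concaveOn.2
      (⟨by positivity, by linarith [Real.pi_pos]⟩ : Real.pi / 6 ∈ Set.Icc 0 Real.pi)
      (⟨le_rfl, Real.pi_pos.le⟩ : (0 : ℝ) ∈ Set.Icc 0 Real.pi)
      (show 0 ≤ 3 / (n : ℝ) by positivity) (sub_nonneg.2 hi) (add_sub_cancel _ _)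
    simp only [smul_eq_mul, Real.sin_zero, mul_zero, add_zero, Real.sin_pi_div_six] at hsin
    rw [show 3 / (n : ℝ) * (Real.pi / 6) = Real.pi / (2 * n) by field_simp; norm_num] at hsin
    have h2 := pow_le_pow_left₀ (by positivity) hsin 2
    have h3 : (2 : ℝ) / m ≤ (3 / (n : ℝ) * (1 / 2)) ^ 2 := by
      rw [mul_pow, div_pow, div_mul_eq_mul_div, div_le_div_iff₀ (by linarith) (by positivity)]
      by_contra hc
      nlinarith
    linarith

theorem six_fifths_mul_sq_le {n m : ℕ} (hm2 : 2 ≤ m) {p : ℝ[X]} (hp : p.degree ≤ n)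
    (h0 : p.eval 0 = 0) (h1 : p.eval 1 = 1)
    (hb : ∀ k : ℕ, k ≤ m → p.eval (k : ℝ) ∈ Set.Icc (0 : ℝ) 1) :
    6 / 5 * (m : ℝ) ^ 2 ≤ (n : ℝ) ^ 4 := by
  by_contra! hnm
  have hn : 2 ≤ n := by
    by_contra! hn
    have hp1 : p.degree ≤ 1 := hp.trans (by exact_mod_cast Nat.lt_succ_iff.1 hn)
    rw [eq_X_add_C_of_degree_le_one hp1] at h0 h1 hb
    have h2 := (hb 2 hm2).2
    simp at h0 h1 h2
    linarith
  have hn0 : (2 : ℝ) ≤ n := by exact_mod_cast hn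
  have hm : 4 ≤ m := by
    by_contra! hm
    have hm' : (m : ℝ) ≤ 3 := by exact_mod_cast Nat.lt_succ_iff.1 hm
    have : (2 : ℝ) ^ 4 ≤ (n : ℝ) ^ 4 := by gcongr
    have hm0 : (0 : ℝ) ≤ m := Nat.cast_nonneg m
    nlinarith
  have hm0 : (4 : ℝ) ≤ m := by exact_mod_cast hm
  have hmpos : (0 : ℝ) < m := by linarith
  set g := p - C (1 / 2) with hg
  have hgd : g.degree ≤ n := (degree_sub_le _ _).trans
    (max_le hp (degree_C_le.trans (by exact_mod_cast Nat.zero_le n)))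
  obtain ⟨ξ, hξ, hmax⟩ := isCompact_Icc.exists_isMaxOn (Set.nonempty_Icc.2 hmpos.le)
    (f := fun t => |g.eval t|) (by fun_prop)
  replace hmax : ∀ t ∈ Set.Icc (0 : ℝ) m, |g.eval t| ≤ |g.eval ξ| := hmax
  set B := |g.eval ξ| with hBdef
  have hgk : ∀ k : ℕ, k ≤ m → |g.eval (k : ℝ)| ≤ 1 / 2 := by
    intro k hk
    have := hb k hk
    rw [hg, eval_sub, eval_C, abs_le]
    constructor <;> linarith [this.1, this.2]
  have hB : 1 / 2 ≤ B := by
    have := hmax 0 ⟨le_rfl, hmpos.le⟩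
    rw [hg, eval_sub, h0, eval_C] at this
    norm_num at this
    linarith
  have hBpos : 0 < B := by linarith
  have hscale : ∀ c : ℝ, |c| = B⁻¹ → ∀ x ∈ Set.Icc (-1 : ℝ) 1,
      |(C c * g.comp (C (-(m / 2 : ℝ)) * X + C (m / 2 : ℝ))).eval x| ≤ 1 := by
    intro c hc x hx
    simp only [eval_mul, eval_comp, eval_add, eval_C, eval_X, abs_mul, hc]
    rw [inv_mul_le_iff₀ hBpos, mul_one]
    apply hmax
    constructor <;> nlinarith [hx.1, hx.2]
  have hdeg : ∀ c : ℝ, (C c * g.comp (C (-(m / 2 : ℝ)) * X + C (m / 2 : ℝ))).degree ≤ n :=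
    fun c => natDegree_le_iff_degree_le.1 ((natDegree_C_mul_le _ _).trans
      (natDegree_le_iff_degree_le.2 (degree_comp_C_mul_X_add_C_le hgd _ _)))
  have hA : ∀ t ∈ Set.Icc (0 : ℝ) m, |(derivative (derivative g)).eval t| ≤ 72 / 25 * B := by
    intro t ht
    have hx : |1 - 2 * t / m| ≤ 1 := by
      have h2 : t / m ≤ 1 := (div_le_one hmpos).2 ht.2
      have h3 : 0 ≤ t / m := div_nonneg ht.1 hmpos.le
      rw [mul_div_assoc, abs_le]
      constructor <;> linarith
    have := abs_second_derivative_le hn (hdeg B⁻¹)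
      (hscale B⁻¹ (abs_of_pos (inv_pos.2 hBpos))) hx
    rw [derivative_C_mul, derivative_C_mul, eval_mul, eval_C,
      eval_second_derivative_comp_C_mul_X_add_C,
      show -(m / 2 : ℝ) * (1 - 2 * t / m) + m / 2 = t by field_simp; ring, abs_mul, abs_mul,
      abs_of_pos (inv_pos.2 hBpos), inv_mul_le_iff₀ hBpos, neg_sq,
      abs_of_nonneg (sq_nonneg _)] at this
    have hm2' : (0 : ℝ) < (m : ℝ) ^ 2 := by positivity
    have h5 : B * (3 / 5 * (n : ℝ) ^ 4) ≤ B * (3 / 5 * (6 / 5 * (m : ℝ) ^ 2)) := by gcongr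
    have h6 : (m : ℝ) ^ 2 * |(derivative (derivative g)).eval t| ≤
        (m : ℝ) ^ 2 * (72 / 25 * B) := by linarith
    exact le_of_mul_le_mul_left h6 hm2'
  have hover := sup_le_of_forall_nat (by positivity) hgk hξ hmax hBdef.symm hA
  have hnode := node_one_le hn hm hnm
  have hsd := (second_difference_le_of_forall_abs_le_one (hdeg (-B⁻¹))
    (hscale (-B⁻¹) (by rw [abs_neg, abs_of_pos (inv_pos.2 hBpos)])) (h := 2 / (m : ℝ))
    (by positivity) hnode).trans
    (second_difference_T_le (one_le_two.trans hn) (by positivity) hnode)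
  simp only [eval_mul, eval_comp, eval_add, eval_C, eval_X] at hsd
  rw [show -(m / 2 : ℝ) * 1 + m / 2 = 0 by ring,
    show -(m / 2 : ℝ) * (1 - 2 / m) + m / 2 = 1 by field_simp; ring,
    show -(m / 2 : ℝ) * (1 - 2 * (2 / m)) + m / 2 = 2 by field_simp; ring] at hsd
  have h2 := (hb 2 (by omega)).2
  rw [Nat.cast_ofNat] at h2
  simp only [hg, eval_sub, eval_C, h0, h1] at hsd
  have h7 : B⁻¹ * 1 ≤ B⁻¹ * (2 - p.eval 2) :=
    mul_le_mul_of_nonneg_left (by linarith) (inv_pos.2 hBpos).le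
  have h8 : B⁻¹ * 1 ≤ 5 / 4 := by linarith
  rw [inv_mul_le_iff₀ hBpos] at h8
  linarith

theorem choose_mul_descFactorial_div {m k t : ℕ} (htm : t ≤ m) :
    (m.choose k : ℝ) * (k.descFactorial t / m.descFactorial t) =
      if t ≤ k then ((m - t).choose (k - t) : ℝ) else 0 := by
  have hpos : (m.descFactorial t : ℝ) ≠ 0 := by
    exact_mod_cast (Nat.descFactorial_pos.2 htm).ne'
  split_ifs with h
  · rw [← mul_div_assoc, div_eq_iff hpos]
    have := Nat.choose_mul (n := m) h
    rw [Nat.descFactorial_eq_factorial_mul_choose, Nat.descFactorial_eq_factorial_mul_choose]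
    have hc : (m.choose k * k.choose t : ℝ) = m.choose t * (m - t).choose (k - t) := by
      exact_mod_cast this
    push_cast
    linear_combination (t.factorial : ℝ) * hc
  · rw [Nat.descFactorial_eq_zero_iff_lt.2 (not_le.1 h)]
    simp

theorem sum_powersetCard_ite_subset {ι : Type*} [Fintype ι] [DecidableEq ι] (t : Finset ι)
    (k : ℕ) :
    ∑ S ∈ Finset.powersetCard k (Finset.univ : Finset ι), (if t ⊆ S then (1 : ℝ) else 0) =
      if t.card ≤ k then ((Fintype.card ι - t.card).choose (k - t.card) : ℝ) else 0 := by
  rw [← Finset.sum_filter, Finset.sum_const, nsmul_one]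
  split_ifs with h
  · rw [Finset.card_filter_powersetCard_subset _ _ _ (Finset.subset_univ t) h, Finset.card_univ]
  · rw [Finset.filter_false_of_mem, Finset.card_empty, Nat.cast_zero]
    intro S hS hts
    exact h ((Finset.card_le_card hts).trans (Finset.mem_powersetCard.1 hS).2.le)

/-- Minsky–Papert symmetrization. -/
theorem exists_symmetrization {ι : Type*} [Fintype ι] [DecidableEq ι] (g : MvPolynomial ι ℝ) :
    ∃ p : ℝ[X], p.natDegree ≤ g.totalDegree ∧ ∀ k : ℕ,
      ((Fintype.card ι).choose k : ℝ) * p.eval (k : ℝ) =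
        ∑ S ∈ Finset.powersetCard k (Finset.univ : Finset ι),
          MvPolynomial.eval (fun i => if i ∈ S then (1 : ℝ) else 0) g := by
  refine ⟨∑ s ∈ g.support, C (g.coeff s / (Fintype.card ι).descFactorial s.support.card) *
    descPochhammer ℝ s.support.card, ?_, ?_⟩
  · refine natDegree_sum_le_of_forall_le _ _ fun s hs => (natDegree_C_mul_le _ _).trans ?_
    rw [descPochhammer_natDegree]
    refine le_trans ?_ (MvPolynomial.le_totalDegree hs)
    rw [Finset.card_eq_sum_ones]
    exact Finset.sum_le_sum fun i hi => Nat.one_le_iff_ne_zero.2 (Finsupp.mem_support_iff.1 hi)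
  · intro k
    simp only [MvPolynomial.eval_eq, eval_finsetSum, eval_mul, eval_C,
      descPochhammer_eval_eq_descFactorial]
    rw [Finset.sum_comm, Finset.mul_sum]
    refine Finset.sum_congr rfl fun s _ => ?_
    rw [← Finset.mul_sum]
    have : ∀ S : Finset ι, ∏ i ∈ s.support, (if i ∈ S then (1 : ℝ) else 0) ^ s i =
        if s.support ⊆ S then 1 else 0 := by
      intro S
      split_ifs with h
      · exact Finset.prod_eq_one fun i hi => by rw [if_pos (h hi), one_pow]
      · obtain ⟨i, hi, hiS⟩ := Finset.not_subset.1 h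
        exact Finset.prod_eq_zero hi (by
          rw [if_neg hiS, zero_pow (Finsupp.mem_support_iff.1 hi)])
    simp only [this]
    rw [sum_powersetCard_ite_subset, ← choose_mul_descFactorial_div (Finset.card_le_univ _)]
    ring

theorem totalDegree_bind₁_le {σ τ : Type*} (g : MvPolynomial σ ℝ) (L : σ → MvPolynomial τ ℝ)
    (hL : ∀ i, (L i).totalDegree ≤ 1) :
    (MvPolynomial.bind₁ L g).totalDegree ≤ g.totalDegree := by
  conv_lhs => rw [g.as_sum]
  rw [map_sum]
  refine MvPolynomial.totalDegree_finsetSum_le fun s hs => ?_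
  rw [MvPolynomial.bind₁_monomial]
  refine (MvPolynomial.totalDegree_mul _ _).trans ?_
  rw [MvPolynomial.totalDegree_C, zero_add]
  refine ((MvPolynomial.totalDegree_finsetProd _ _).trans ?_).trans
    (MvPolynomial.le_totalDegree hs)
  refine Finset.sum_le_sum fun i _ => (MvPolynomial.totalDegree_pow _ _).trans ?_
  calc s i * (L i).totalDegree ≤ s i * 1 := Nat.mul_le_mul_left _ (hL i)
    _ = s i := mul_one _

/-- The polynomial in one variable per block whose value at `z` is the value of the representing
polynomial at the input `x` with the blocks selected by `z` flipped. -/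
theorem exists_block_polynomial {n : ℕ} (f : BooleanFunction n) (x : Fin n → Bool)
    (B : Finset (Finset (Fin n))) (hB : ∀ R ∈ B, ∀ S ∈ B, R ≠ S → Disjoint R S) :
    ∃ g : MvPolynomial B ℝ, g.totalDegree ≤ degree f ∧ ∀ S : Finset B,
      MvPolynomial.eval (fun R => if R ∈ S then (1 : ℝ) else 0) g =
        bit (f (flip x (S.biUnion fun R => (R : Finset (Fin n))))) := by
  let L : Fin n → MvPolynomial B ℝ := fun i => MvPolynomial.C (bit (x i)) +
    MvPolynomial.C (1 - 2 * bit (x i)) *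
      ∑ R ∈ Finset.univ.filter (fun R : B => i ∈ (R : Finset (Fin n))), MvPolynomial.X R
  refine ⟨MvPolynomial.bind₁ L (poly f), totalDegree_bind₁_le _ _ fun i => ?_, fun S => ?_⟩
  · refine (MvPolynomial.totalDegree_add _ _).trans (max_le ?_ ?_)
    · rw [MvPolynomial.totalDegree_C]; exact zero_le_one
    · refine (MvPolynomial.totalDegree_mul _ _).trans ?_
      rw [MvPolynomial.totalDegree_C, zero_add]
      exact MvPolynomial.totalDegree_finsetSum_le fun R _ => (MvPolynomial.totalDegree_X R).le
  · rw [← (poly_represents f).2, ← MvPolynomial.coe_aeval_eq_eval, RingHom.coe_coe,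
      MvPolynomial.aeval_bind₁, ← MvPolynomial.coe_aeval_eq_eval, RingHom.coe_coe]
    congr 2
    funext i
    have hsum : ∑ R ∈ Finset.univ.filter (fun R : B => i ∈ (R : Finset (Fin n))),
        (if R ∈ S then (1 : ℝ) else 0) =
        if i ∈ S.biUnion (fun R => (R : Finset (Fin n))) then 1 else 0 := by
      split_ifs with h
      · obtain ⟨R, hRS, hiR⟩ := Finset.mem_biUnion.1 h
        rw [Finset.sum_eq_single R, if_pos hRS]
        · intro R' hR' hne
          exfalso
          have hd := hB R' R'.2 R R.2 fun e => hne (Subtype.ext e)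
          exact Finset.disjoint_left.1 hd (Finset.mem_filter.1 hR').2 hiR
        · intro hR
          exact absurd (Finset.mem_filter.2 ⟨Finset.mem_univ R, hiR⟩) hR
      · refine Finset.sum_eq_zero fun R hR => if_neg fun hRS => h ?_
        exact Finset.mem_biUnion.2 ⟨R, hRS, (Finset.mem_filter.1 hR).2⟩
    simp only [L, map_add, map_mul, map_sum, MvPolynomial.aeval_X, MvPolynomial.aeval_C, hsum,
      Algebra.algebraMap_self, RingHom.id_apply]
    unfold flip
    split_ifs <;> cases x i <;> norm_num [bit]

theorem exists_univariate_polynomial {n : ℕ} (f : BooleanFunction n) (x : Fin n → Bool)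
    (B : Finset (Finset (Fin n))) (hB : ∀ R ∈ B, ∀ S ∈ B, R ≠ S → Disjoint R S)
    (hf : ∀ R ∈ B, f x ≠ f (flip x R)) (h1 : 1 ≤ B.card) :
    ∃ p : ℝ[X], p.degree ≤ degree f ∧ p.eval 0 = bit (f x) ∧ p.eval 1 = 1 - bit (f x) ∧
      ∀ k : ℕ, k ≤ B.card → p.eval (k : ℝ) ∈ Set.Icc (0 : ℝ) 1 := by
  classical
  obtain ⟨g, hgd, hg⟩ := exists_block_polynomial f x B hB
  obtain ⟨p, hpd, hp⟩ := exists_symmetrization g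
  rw [Fintype.card_coe] at hp
  simp only [hg] at hp
  have hbit : ∀ b : Bool, bit b ∈ Set.Icc (0 : ℝ) 1 := by
    intro b; cases b <;> norm_num [bit]
  refine ⟨p, natDegree_le_iff_degree_le.1 (hpd.trans hgd), ?_, ?_, fun k hk => ?_⟩
  · have := hp 0
    rw [Finset.powersetCard_zero, Finset.sum_singleton, Nat.choose_zero_right] at this
    have hflip : flip x ∅ = x := by funext i; simp [flip]
    simpa [hflip] using this
  · have := hp 1
    rw [Finset.powersetCard_one, Finset.sum_map, Nat.choose_one_right, Nat.cast_one] at this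
    have hc : ∀ R : B, bit (f (flip x (Finset.biUnion {R} fun R => (R : Finset (Fin n))))) =
        1 - bit (f x) := by
      intro R
      rw [Finset.singleton_biUnion]
      have := hf R R.2
      revert this
      cases f x <;> cases f (flip x R) <;> norm_num [bit]
    simp only [Function.Embedding.coeFn_mk, hc, Finset.sum_const, Finset.card_univ,
      Fintype.card_coe, nsmul_eq_mul] at this
    have hpos : (B.card : ℝ) ≠ 0 := by exact_mod_cast (Nat.one_le_iff_ne_zero.1 h1)
    exact mul_left_cancel₀ hpos this
  · have := hp k
    have hpos : (0 : ℝ) < B.card.choose k := by exact_mod_cast Nat.choose_pos hk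
    have hcard : (Finset.powersetCard k (Finset.univ : Finset B)).card = B.card.choose k := by
      rw [Finset.card_powersetCard, Finset.card_univ, Fintype.card_coe]
    constructor
    · refine nonneg_of_mul_nonneg_right (this.symm ▸ Finset.sum_nonneg fun S _ => (hbit _).1) hpos
    · have hle := Finset.sum_le_card_nsmul (Finset.powersetCard k (Finset.univ : Finset B))
        (fun S => bit (f (flip x (S.biUnion fun R => (R : Finset (Fin n)))))) 1
        fun S _ => (hbit _).2
      rw [← this, hcard, nsmul_one] at hle
      exact (mul_le_iff_le_one_right hpos).1 hle

theorem six_fifths_mul_blockSensitivity_sq_le {n : ℕ} (f : BooleanFunction n)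
    (hf : 2 ≤ blockSensitivity f) :
    6 / 5 * (blockSensitivity f : ℝ) ^ 2 ≤ (degree f : ℝ) ^ 4 := by
  obtain ⟨x, -, hx⟩ := Finset.exists_mem_eq_sup Finset.univ Finset.univ_nonempty
    (localBlockSensitivity f)
  obtain ⟨B, hB, hBc⟩ := Finset.exists_mem_eq_sup
    ((Finset.univ : Finset (Finset (Finset (Fin n)))).filter fun B =>
      (∀ R ∈ B, ∀ S ∈ B, R ≠ S → Disjoint R S) ∧ ∀ R ∈ B, f x ≠ f (flip x R))
    ⟨∅, by simp⟩ Finset.card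
  have hcard : blockSensitivity f = B.card := hx.trans hBc
  obtain ⟨-, hdis, hsens⟩ := Finset.mem_filter.1 hB
  rw [hcard] at hf ⊢
  obtain ⟨p, hpd, hp0, hp1, hpb⟩ := exists_univariate_polynomial f x B hdis hsens
    (one_le_two.trans hf)
  cases hfx : f x
  · refine six_fifths_mul_sq_le hf hpd ?_ ?_ hpb
    · rw [hp0, hfx]; simp [bit]
    · rw [hp1, hfx]; simp [bit]
  · refine six_fifths_mul_sq_le (p := 1 - p) hf ?_ ?_ ?_ fun k hk => ?_
    · refine (degree_sub_le _ _).trans (max_le (degree_one_le.trans ?_) hpd)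
      exact_mod_cast Nat.zero_le _
    · rw [eval_sub, hp0, hfx]; simp [bit]
    · rw [eval_sub, hp1, hfx]; simp [bit]
    · have := hpb k hk
      rw [eval_sub, eval_one]
      constructor <;> linarith [this.1, this.2]

end BoolFun

theorem mainTheorem7 (n : ℕ) (f : BoolFun.BooleanFunction n)
    (hf : BoolFun.blockSensitivity f ≠ 1) :
    Real.sqrt (6 / 5) * (BoolFun.blockSensitivity f : ℝ) ≤ (BoolFun.degree f : ℝ) ^ 2 ∧
      1.09 < Real.sqrt (6 / 5) ∧ Real.sqrt (6 / 5) < 1.1 := by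
  refine ⟨?_, ?_, ?_⟩
  · rcases Nat.lt_or_ge (BoolFun.blockSensitivity f) 2 with h | h
    · have h0 : BoolFun.blockSensitivity f = 0 := by omega
      rw [h0, Nat.cast_zero, mul_zero]
      positivity
    · have key := BoolFun.six_fifths_mul_blockSensitivity_sq_le f h
      refine (sq_le_sq₀ (by positivity) (by positivity)).1 ?_
      rw [mul_pow, Real.sq_sqrt (by norm_num), ← pow_mul]
      exact key
  · rw [Real.lt_sqrt (by norm_num)]; norm_num
  · rw [Real.sqrt_lt' (by norm_num)]; norm_num
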